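/- Let $S>0$ be an integer and let $p_0$ be a probability mass function (pmf) on $\mathbb{N}=\{0,1,2,\dots\}$ with support exactly $\{0,\dots,S\}$ which is convex on $\mathbb{N}$, i.e. $\Delta p_0(k):=p_0(k+1)-2p_0(k)+p_0(k-1)\ge 0$ for all $k\ge 1$. Let $X_1,X_2,\dots$ be i.i.d. with pmf $p_0$, let $p_n(j)=n^{-1}\sum_{i=1}^n \mathbb{1}_{\{X_i=j\}}$ be the empirical pmf, and write $\|q\|^2=\sum_{j\in\mathbb{N}}q(j)^2$. Let $\hat p_n$ be the minimizer of $\|p_n-p\|^2$ over all convex pmfs $p$ on $\mathbb{N}$ (it exists and is unique for every $n\ge 1$), and let $T_n=\sqrt n\,\|p_n-\hat p_n\|$. Let $g_0=(g_0(0),\dots,g_0(S+1))$ be a centered Gaussian vector in $\mathbb{R}^{S+2}$ with covariances $\mathbb{1}_{\{i=j\}}p_0(i)-p_0(i)p_0(j)$, $0\le i,j\le S+1$. Call $k\ge1$ a knot of $p_0$ if $\Delta p_0(k)>0$, and let $\mathcal{K}_0$ be the set of all $g=(g(0),\dots,g(S+1))\in\mathbb{R}^{S+2}$ with $\Delta g(k)=g(k+1)-2g(k)+g(k-1)\ge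 0$ for every $k\in\{1,\dots,S\}$ that is not a knot of $p_0$. Let $\hat g_0$ be the minimizer of $\sum_{k=0}^{S+1}(g(k)-g_0(k))^2$ over $g\in\mathcal{K}_0$ (it exists and is unique). Then, as $n\to\infty$, $$T_n\ \stackrel{d}{\longrightarrow}\ \hat T_0:=\Big(\sum_{k=0}^{S+1}\big(\hat g_0(k)-g_0(k)\big)^2\Big)^{1/2}.$$ -/

import Mathlib

open MeasureTheory ProbabilityTheory Filter

namespace ConvexTest

noncomputable section

/-- A minimizer of `f` over the set `C` (an unspecified element if there is none). -/
def argminOn {α : Type*} [Nonempty α] (f : α → ℝ) (C : Set α) : α :=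
  Classical.epsilon fun x => x ∈ C ∧ IsMinOn f C x

/-- The second difference `Δp(k) = p(k+1) - 2 p(k) + p(k-1)` of a sequence on `ℕ`
(only used for `k ≥ 1`). -/
def secondDiff (p : ℕ → ℝ) (k : ℕ) : ℝ := p (k + 1) - 2 * p k + p (k - 1)

/-- `p` is convex on `ℕ`. -/
def IsConvexSeq (p : ℕ → ℝ) : Prop := ∀ k, 1 ≤ k → 0 ≤ secondDiff p k

/-- `k` is a knot of `p`. -/
def IsKnot (p : ℕ → ℝ) (k : ℕ) : Prop := 1 ≤ k ∧ 0 < secondDiff p k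

/-- `p` is a probability mass function on `ℕ`. -/
def IsPmf (p : ℕ → ℝ) : Prop := (∀ k, 0 ≤ p k) ∧ HasSum p 1

/-- The set of all convex probability mass functions on `ℕ`. -/
def convexPmfs : Set (ℕ → ℝ) := {p | IsPmf p ∧ IsConvexSeq p}

/-- `‖q‖² = ∑_j q(j)²`. It is only applied to differences of probability mass functions, for which
the series converges. -/
def normSq (q : ℕ → ℝ) : ℝ := ∑' j, q j ^ 2

/-- The empirical probability mass function of the first `n` observations. -/
def empiricalPmf {Ω : Type*} (X : ℕ → Ω → ℕ) (n : ℕ) (ω : Ω) : ℕ → ℝ := fun j =>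
  (n : ℝ)⁻¹ * ∑ i ∈ Finset.range n, if X i ω = j then 1 else 0

/-- The convex least-squares estimator: the minimizer of `‖pₙ - p‖²` over convex pmfs `p`. -/
def convexLSE {Ω : Type*} (X : ℕ → Ω → ℕ) (n : ℕ) (ω : Ω) : ℕ → ℝ :=
  argminOn (fun p => normSq (empiricalPmf X n ω - p)) convexPmfs

/-- The test statistic `Tₙ = √n ‖pₙ - p̂ₙ‖`. -/
def testStat {Ω : Type*} (X : ℕ → Ω → ℕ) (n : ℕ) (ω : Ω) : ℝ :=
  √(n : ℝ) * √(normSq (empiricalPmf X n ω - convexLSE X n ω))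

/-- The dispersion matrix `Γ₀`, with entries `1_{i = j} p(i) - p(i) p(j)`, `0 ≤ i, j ≤ S + 1`. -/
def dispersion (p : ℕ → ℝ) (S : ℕ) : Matrix (Fin (S + 2)) (Fin (S + 2)) ℝ :=
  Matrix.of fun i j => (if i = j then p i else 0) - p i * p j

/-- The cone `𝒦₀` of vectors `(g(0), …, g(S+1))` with `Δg(k) ≥ 0` for all `k ∈ {1, …, S}` except
possibly at the knots of `p`. -/
def knotCone (p : ℕ → ℝ) (S : ℕ) : Set (EuclideanSpace ℝ (Fin (S + 2))) :=
  {g | ∀ (k : ℕ) (_ : 1 ≤ k) (_ : k ≤ S), ¬ IsKnot p k →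
    0 ≤ g ⟨k + 1, by omega⟩ - 2 * g ⟨k, by omega⟩ + g ⟨k - 1, by omega⟩}

/-- The sum of squares `∑_{k=0}^{S+1} (g(k) - u(k))²`. -/
def sumSq {S : ℕ} (u g : EuclideanSpace ℝ (Fin (S + 2))) : ℝ := ∑ k, (g k - u k) ^ 2

/-- The least-squares projection of `u` onto `𝒦₀`. -/
def coneProj (p : ℕ → ℝ) (S : ℕ) (u : EuclideanSpace ℝ (Fin (S + 2))) :
    EuclideanSpace ℝ (Fin (S + 2)) :=
  argminOn (sumSq u) (knotCone p S)

end

end ConvexTest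

open ConvexTest

/-! Everything becomes a distance to the closed convex cone C of convex sequences in ℓ². The
projection of a pmf onto C is already a pmf (`isPmf_of_projection`), so the estimator is that
projection, and since C is a cone, `testStat` is the distance from √n pₙ to C
(`testStat_eq_infDist`). Almost surely √n pₙ is the fluctuation vector Wₙ, extended by zero, plus √n
p₀. Hence the statistic is F_t(Wₙ) at t = √n, where F_t(g) = dist(g + t p₀, C) is `shiftedDist`.

F_t decreases in t because C + p₀ ⊆ C, and it is bounded below by dist(g, 𝒦₀) because subtracting t
p₀ from an element of C can break convexity only at knots of p₀. If g(S+1) = 0, equality holds for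
all large t: the projection of g onto 𝒦₀ has a nonnegative last entry, so after extension by zero
its only negative second differences lie at knots of p₀, where t p₀ outweighs them
(`eventually_shiftedDist_eq`). The Gaussian limit satisfies g₀(S+1) = 0 almost surely, as p₀(S+1) =
0.

It remains to combine the central limit theorem for Wₙ with a continuous-mapping argument for
functions varying with n. Monotonicity in n makes pointwise convergence on the limit law sufficient
(`tendstoInDistribution_of_antitone`). -/

namespace ConvexTest

open Topology

/-- The Hilbert space `ℓ²(ℕ)`. -/
abbrev EllTwo : Type := lp (fun _ : ℕ => ℝ) 2

/-! ### Convex sequences -/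

theorem IsConvexSeq.add {p q : ℕ → ℝ} (hp : IsConvexSeq p) (hq : IsConvexSeq q) :
    IsConvexSeq (p + q) := fun k hk => by
  have := hp k hk
  have := hq k hk
  simp only [secondDiff, Pi.add_apply] at *
  linarith

theorem IsConvexSeq.smul {p : ℕ → ℝ} (hp : IsConvexSeq p) {c : ℝ} (hc : 0 ≤ c) :
    IsConvexSeq (c • p) := fun k hk => by
  have := mul_nonneg hc (hp k hk)
  simp only [secondDiff, Pi.smul_apply, smul_eq_mul] at *
  linarith

theorem IsConvexSeq.monotone_diff {p : ℕ → ℝ} (hp : IsConvexSeq p) :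
    Monotone fun k => p (k + 1) - p k :=
  monotone_nat_of_le_succ fun k => by
    have := hp (k + 1) (by omega)
    simp only [secondDiff, Nat.add_sub_cancel] at this
    linarith

theorem IsConvexSeq.antitone {p : ℕ → ℝ} (hp : IsConvexSeq p) (h0 : Tendsto p atTop (𝓝 0)) :
    Antitone p := by
  have hd : Tendsto (fun k => p (k + 1) - p k) atTop (𝓝 0) := by
    simpa using ((tendsto_add_atTop_iff_nat 1).2 h0).sub h0
  exact antitone_nat_of_succ_le fun k => sub_nonpos.1 (hp.monotone_diff.ge_of_tendsto hd k)

theorem IsConvexSeq.nonneg {p : ℕ → ℝ} (hp : IsConvexSeq p) (h0 : Tendsto p atTop (𝓝 0)) (k : ℕ) :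
    0 ≤ p k :=
  (hp.antitone h0).le_of_tendsto h0 k

/-- A convex sequence tending to zero vanishes beyond its last knot. -/
theorem IsConvexSeq.eq_zero_of_no_knot {p : ℕ → ℝ} (hp : IsConvexSeq p)
    (h0 : Tendsto p atTop (𝓝 0)) {s : ℕ} (hs : ∀ k, s < k → ¬ IsKnot p k) {k : ℕ} (hk : s ≤ k) :
    p k = 0 := by
  have hd : Tendsto (fun k => p (k + 1) - p k) atTop (𝓝 0) := by
    simpa using ((tendsto_add_atTop_iff_nat 1).2 h0).sub h0
  have hstep : ∀ i, p (s + i + 1) - p (s + i) = p (s + 1) - p s := by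
    intro i
    induction i with
    | zero => simp
    | succ i ih =>
      have h1 := hs (s + i + 1) (by omega)
      have h2 := hp (s + i + 1) (by omega)
      simp only [IsKnot, not_and, not_lt] at h1
      have h3 := le_antisymm (h1 (by omega)) h2
      simp only [secondDiff, Nat.add_sub_cancel] at h3
      rw [← add_assoc]
      linarith
  -- The increments are constant beyond s and tend to 0.
  have hconst : p (s + 1) - p s = 0 := by
    refine tendsto_nhds_unique ?_ ((tendsto_add_atTop_iff_nat s).2 hd)
    refine tendsto_const_nhds.congr fun i => ?_
    rw [← hstep i, add_comm s i]
  have hp' : ∀ i, p (s + i) = p s := by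
    intro i
    induction i with
    | zero => simp
    | succ i ih => rw [← add_assoc]; linarith [hstep i]
  have hps : p s = 0 := by
    refine tendsto_nhds_unique ?_ ((tendsto_add_atTop_iff_nat s).2 h0)
    refine tendsto_const_nhds.congr fun i => ?_
    rw [← hp' i, add_comm s i]
  obtain ⟨i, rfl⟩ := Nat.exists_eq_add_of_le hk
  rw [hp', hps]

/-! ### The cone of convex sequences in `ℓ²` -/

/-- The closed convex cone of square-summable convex sequences. -/
def convexCone : Set EllTwo := {f | IsConvexSeq f}

theorem mem_convexCone {f : EllTwo} : f ∈ convexCone ↔ IsConvexSeq f := Iff.rfl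

theorem continuous_ellTwo_apply (j : ℕ) : Continuous fun f : EllTwo => f j :=
  (continuous_apply j).comp (lp.uniformContinuous_coe (E := fun _ : ℕ => ℝ) (p := 2)).continuous

theorem zero_mem_convexCone : (0 : EllTwo) ∈ convexCone := fun k _ => by
  simp [secondDiff]

theorem add_mem_convexCone {f g : EllTwo} (hf : f ∈ convexCone) (hg : g ∈ convexCone) :
    f + g ∈ convexCone := by
  rw [mem_convexCone, lp.coeFn_add]
  exact IsConvexSeq.add hf hg

theorem smul_mem_convexCone {f : EllTwo} (hf : f ∈ convexCone) {c : ℝ} (hc : 0 ≤ c) :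
    c • f ∈ convexCone := by
  rw [mem_convexCone, lp.coeFn_smul]
  exact IsConvexSeq.smul hf hc

theorem convex_convexCone : Convex ℝ convexCone := fun _ hf _ hg _ _ ha hb _ =>
  add_mem_convexCone (smul_mem_convexCone hf ha) (smul_mem_convexCone hg hb)

theorem isClosed_convexCone : IsClosed convexCone := by
  have : convexCone = ⋂ k : ℕ, ⋂ _ : 1 ≤ k, {f : EllTwo | 0 ≤ f (k + 1) - 2 * f k + f (k - 1)} := by
    ext f
    simp [convexCone, IsConvexSeq, secondDiff]
  rw [this]
  refine isClosed_iInter fun k => isClosed_iInter fun _ => isClosed_le continuous_const ?_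
  let e (j : ℕ) : EllTwo → ℝ := fun f => f j
  have he (j : ℕ) : Continuous (e j) := continuous_ellTwo_apply j
  exact ((he (k + 1)).sub ((he k).const_mul 2)).add (he (k - 1))

theorem summable_sq_ellTwo (f : EllTwo) : Summable fun j => f j ^ 2 := by
  have := (lp.memℓp f).summable (by norm_num)
  simpa using this

theorem normSq_coe (f : EllTwo) : normSq f = ‖f‖ ^ 2 := by
  have := lp.norm_rpow_eq_tsum (p := 2) (by norm_num) f
  simp only [ENNReal.toReal_ofNat, Real.rpow_ofNat, Real.norm_eq_abs, sq_abs] at this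
  rw [this, normSq]

theorem tendsto_ellTwo (f : EllTwo) : Tendsto f atTop (𝓝 0) := by
  have h := (summable_sq_ellTwo f).tendsto_atTop_zero
  have h2 := h.sqrt
  simp only [Real.sqrt_sq_eq_abs, Real.sqrt_zero] at h2
  exact (tendsto_zero_iff_abs_tendsto_zero _).2 h2

/-- A probability mass function as an element of `ℓ²`. -/
theorem IsPmf.memℓp {p : ℕ → ℝ} (hp : IsPmf p) : Memℓp p 2 := by
  have h1 : Memℓp (p : ∀ _ : ℕ, ℝ) 1 := by
    refine memℓp_gen ?_
    simpa using hp.2.summable.abs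
  exact h1.of_exponent_ge (by norm_num)

/-- The function `j ↦ (L - j)⁺` as an element of `ℓ²`. -/
noncomputable def hinge (L : ℕ) : EllTwo := ∑ j ∈ Finset.range L, lp.single 2 j ((L : ℝ) - j)

theorem hinge_apply (L k : ℕ) : hinge L k = ((L - k : ℕ) : ℝ) := by
  rw [hinge, lp.coeFn_sum, Finset.sum_apply]
  simp only [lp.coeFn_single, Finset.sum_pi_single, Finset.mem_range]
  split_ifs with h
  · rw [Nat.cast_sub h.le]
  · simp [Nat.sub_eq_zero_of_le (not_lt.1 h)]

/-- A hinge has its only kink at L, so adding or subtracting multiples of it perturbs the convexity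
constraint at L alone. -/
theorem secondDiff_hinge (L : ℕ) {k : ℕ} (hk : 1 ≤ k) :
    secondDiff (hinge L) k = if k = L then 1 else 0 := by
  simp only [secondDiff, hinge_apply]
  obtain h | rfl | h := lt_trichotomy k L
  · rw [if_neg h.ne, Nat.cast_sub (by omega), Nat.cast_sub (by omega), Nat.cast_sub (by omega),
      Nat.cast_sub hk]
    push_cast
    ring
  · rw [if_pos rfl]
    have h1 : k - (k - 1) = 1 := by omega
    simp [h1]
  · have h1 : L - (k - 1) = 0 := by omega
    have h2 : L - k = 0 := by omega
    have h3 : L - (k + 1) = 0 := by omega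
    simp [h1, h2, h3, h.ne']

theorem hinge_mem_convexCone (L : ℕ) : hinge L ∈ convexCone := fun k hk => by
  rw [secondDiff_hinge L hk]
  split_ifs <;> norm_num

theorem inner_hinge (f : EllTwo) (L : ℕ) :
    inner ℝ f (hinge L) = ∑ j ∈ Finset.range L, f j * ((L : ℝ) - j) := by
  rw [hinge, inner_sum]
  refine Finset.sum_congr rfl fun j _ => ?_
  rw [lp.inner_single_right]
  simp [mul_comm]

/-- Converts the projection inequalities tested on hinges into statements about cumulative mass. -/
theorem inner_hinge_succ_sub (f : EllTwo) (L : ℕ) :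
    inner ℝ f (hinge (L + 1)) - inner ℝ f (hinge L) = ∑ j ∈ Finset.range (L + 1), f j := by
  rw [inner_hinge, inner_hinge, Finset.sum_range_succ, Finset.sum_range_succ (f ·),
    add_sub_right_comm, ← Finset.sum_sub_distrib]
  congr 1
  · refine Finset.sum_congr rfl fun j _ => ?_
    push_cast
    ring
  · push_cast
    ring

/-! ### Projection onto the cone -/

/-- Variational characterization of the projection onto a closed convex set. -/
theorem exists_projection {F : Type*} [NormedAddCommGroup F] [InnerProductSpace ℝ F]
    [CompleteSpace F] {K : Set F} (hne : K.Nonempty) (hcl : IsClosed K) (hconv : Convex ℝ K)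
    (u : F) : ∃ v ∈ K, ∀ w ∈ K, inner ℝ (u - v) (w - v) ≤ 0 := by
  obtain ⟨v, hv, h⟩ := exists_norm_eq_iInf_of_complete_convex hne hcl.isComplete hconv u
  exact ⟨v, hv, (norm_eq_iInf_iff_real_inner_le_zero hconv hv).1 h⟩

/-- The obtuse-angle form of Pythagoras; the extra term ‖w - v‖² gives uniqueness as well as
minimality. -/
theorem norm_sq_add_le_of_projection {F : Type*} [NormedAddCommGroup F] [InnerProductSpace ℝ F]
    {K : Set F} {u v : F} (h : ∀ w ∈ K, inner ℝ (u - v) (w - v) ≤ 0) {w : F} (hw : w ∈ K) :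
    ‖u - v‖ ^ 2 + ‖w - v‖ ^ 2 ≤ ‖u - w‖ ^ 2 := by
  have h1 : u - w = (u - v) - (w - v) := by abel
  rw [h1, norm_sub_sq_real (u - v)]
  linarith [h w hw]

theorem infDist_eq_of_projection {F : Type*} [NormedAddCommGroup F] [InnerProductSpace ℝ F]
    {K : Set F} {u v : F} (hv : v ∈ K) (h : ∀ w ∈ K, inner ℝ (u - v) (w - v) ≤ 0) :
    Metric.infDist u K = ‖u - v‖ := by
  refine le_antisymm ?_ ?_
  · rw [← dist_eq_norm]
    exact Metric.infDist_le_dist_of_mem hv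
  · rw [Metric.le_infDist ⟨v, hv⟩]
    intro w hw
    rw [dist_eq_norm]
    refine le_of_sq_le_sq ?_ (norm_nonneg _)
    nlinarith [norm_sq_add_le_of_projection h hw, sq_nonneg ‖w - v‖]

theorem inner_le_zero_of_projection_convexCone {u v : EllTwo} (hv : v ∈ convexCone)
    (h : ∀ w ∈ convexCone, inner ℝ (u - v) (w - v) ≤ 0) {w : EllTwo} (hw : w ∈ convexCone) :
    inner ℝ (u - v) w ≤ 0 := by
  simpa using h (v + w) (add_mem_convexCone hv hw)

/-- Complementary slackness: at a knot of v the constraint is inactive, so a small multiple of the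
hinge can also be subtracted, which reverses the inequality. -/
theorem inner_hinge_eq_zero_of_isKnot {u v : EllTwo} (hv : v ∈ convexCone)
    (h : ∀ w ∈ convexCone, inner ℝ (u - v) (w - v) ≤ 0) {s : ℕ} (hs : IsKnot v s) :
    inner ℝ (u - v) (hinge s) = 0 := by
  refine le_antisymm (inner_le_zero_of_projection_convexCone hv h (hinge_mem_convexCone s)) ?_
  have hmem : v - secondDiff v s • hinge s ∈ convexCone := by
    intro k hk
    have h1 : secondDiff (v - secondDiff v s • hinge s : EllTwo) k
        = secondDiff v k - secondDiff v s * secondDiff (hinge s) k := by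
      simp only [secondDiff, lp.coeFn_sub, lp.coeFn_smul, Pi.sub_apply, Pi.smul_apply, smul_eq_mul]
      ring
    rw [h1, secondDiff_hinge s hk]
    split_ifs with hks
    · simp [hks]
    · simpa using hv k hk
  have h2 := h _ hmem
  rw [sub_sub_cancel_left, inner_neg_right, inner_smul_right] at h2
  nlinarith [hs.2]

/-- The projection of a probability mass function onto the cone of convex sequences is a
probability mass function. -/
theorem isPmf_of_projection {u v : EllTwo} (hu : IsPmf u) (hv : v ∈ convexCone)
    (h : ∀ w ∈ convexCone, inner ℝ (u - v) (w - v) ≤ 0) : IsPmf v := by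
  have hv0 := IsConvexSeq.nonneg hv (tendsto_ellTwo v)
  have hle : ∀ L, inner ℝ (u - v) (hinge L) ≤ 0 := fun L =>
    inner_le_zero_of_projection_convexCone hv h (hinge_mem_convexCone L)
  -- With s = t + 1, the pairing of u - v vanishes at s and is ≤ 0 at t, so u - v has nonnegative
  -- mass on {0, …, t}.
  have hknot : ∀ s, IsKnot v s → ∑ j ∈ Finset.range s, v j ≤ 1 := by
    intro s hs
    obtain ⟨t, rfl⟩ := Nat.exists_eq_add_of_le' hs.1
    have h1 := inner_hinge_succ_sub (u - v) t
    rw [inner_hinge_eq_zero_of_isKnot hv h hs] at h1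
    simp only [lp.coeFn_sub, Pi.sub_apply, Finset.sum_sub_distrib] at h1
    have h2 := hle t
    have h3 := sum_le_hasSum (Finset.range (t + 1)) (fun i _ => hu.1 i) hu.2
    linarith
  -- Compare with a knot at or beyond L if there is one; otherwise with the last knot, past which v
  -- vanishes. Without knots, v = 0.
  have hbound : ∀ L, ∑ j ∈ Finset.range L, v j ≤ 1 := by
    intro L
    by_cases hex : ∃ s, L ≤ s ∧ IsKnot v s
    · obtain ⟨s, hLs, hs⟩ := hex
      exact (Finset.sum_le_sum_of_subset_of_nonneg (Finset.range_subset_range.2 hLs)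
        fun i _ _ => hv0 i).trans (hknot s hs)
    · push Not at hex
      classical
      by_cases hex2 : ∃ s, IsKnot v s
      · obtain ⟨s₀, hs₀⟩ := hex2
        have hs₀L : s₀ ≤ L := by
          by_contra hc
          exact hex s₀ (by omega) hs₀
        have hs := Nat.findGreatest_spec (P := IsKnot v) hs₀L hs₀
        have hsL := Nat.findGreatest_le (P := IsKnot v) L
        have hmax : ∀ k, Nat.findGreatest (IsKnot v) L < k → ¬ IsKnot v k := by
          intro k hk
          by_cases hkL : k ≤ L
          · exact Nat.findGreatest_is_greatest hk hkL
          · exact hex k (by omega)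
        set s := Nat.findGreatest (IsKnot v) L
        rw [← Finset.sum_range_add_sum_Ico _ hsL]
        have : ∑ j ∈ Finset.Ico s L, v j = 0 := Finset.sum_eq_zero fun j hj =>
          IsConvexSeq.eq_zero_of_no_knot hv (tendsto_ellTwo v) hmax (Finset.mem_Ico.1 hj).1
        rw [this, add_zero]
        exact hknot s hs
      · push Not at hex2
        rw [Finset.sum_eq_zero fun j _ => IsConvexSeq.eq_zero_of_no_knot hv (tendsto_ellTwo v)
          (s := 0) (fun k _ => hex2 k) (Nat.zero_le j)]
        exact zero_le_one
  have hsum : Summable v := summable_of_sum_range_le hv0 hbound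
  have hle1 : ∑' j, v j ≤ 1 := Real.tsum_le_of_sum_range_le hv0 hbound
  refine ⟨hv0, ?_⟩
  -- If mass were missing, the hinge pairings of u - v would eventually grow by at least c > 0 per
  -- step, contradicting that they stay ≤ 0.
  have hge1 : 1 ≤ ∑' j, v j := by
    by_contra! hlt
    have hlim : Tendsto (fun k => ∑ j ∈ Finset.range (k + 1), (u - v : EllTwo) j) atTop
        (𝓝 (1 - ∑' j, v j)) :=
      (tendsto_add_atTop_iff_nat 1).2 (hu.2.sub hsum.hasSum).tendsto_sum_nat
    have hc : 0 < (1 - ∑' j, v j) / 2 := by linarith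
    obtain ⟨N, hN⟩ := eventually_atTop.1
      (hlim.eventually_const_lt (show (1 - ∑' j, v j) / 2 < 1 - ∑' j, v j by linarith))
    set c := (1 - ∑' j, v j) / 2
    have hgrow : ∀ m : ℕ, inner ℝ (u - v) (hinge N) + m * c ≤ inner ℝ (u - v) (hinge (N + m)) := by
      intro m
      induction m with
      | zero => simp
      | succ m ih =>
        have := inner_hinge_succ_sub (u - v) (N + m)
        have := hN (N + m) (by omega)
        rw [← add_assoc]
        push_cast
        linarith
    obtain ⟨m, hm⟩ := exists_nat_gt (-inner ℝ (u - v) (hinge N) / c)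
    rw [div_lt_iff₀ hc] at hm
    linarith [hgrow m, hle (N + m)]
  rw [← le_antisymm hle1 hge1]
  exact hsum.hasSum

theorem normSq_sub_coe (u f : EllTwo) : normSq ((u : ℕ → ℝ) - f) = ‖u - f‖ ^ 2 := by
  rw [← lp.coeFn_sub, normSq_coe]

/-- Existence and uniqueness of the convex least-squares fit of a probability mass function `u`,
together with the value of the minimum. -/
theorem exists_unique_convexFit {u : EllTwo} (hu : IsPmf u) :
    (∃! p, p ∈ convexPmfs ∧ IsMinOn (fun q => normSq ((u : ℕ → ℝ) - q)) convexPmfs p) ∧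
    ∀ p, p ∈ convexPmfs → IsMinOn (fun q => normSq ((u : ℕ → ℝ) - q)) convexPmfs p →
      √(normSq ((u : ℕ → ℝ) - p)) = Metric.infDist u convexCone := by
  obtain ⟨v, hv, h⟩ := exists_projection ⟨0, zero_mem_convexCone⟩ isClosed_convexCone
    convex_convexCone u
  have hvP : (v : ℕ → ℝ) ∈ convexPmfs := ⟨isPmf_of_projection hu hv h, hv⟩
  have hmin : IsMinOn (fun q => normSq ((u : ℕ → ℝ) - q)) convexPmfs v := by
    intro q hq
    have := norm_sq_add_le_of_projection h (w := ⟨q, hq.1.memℓp⟩) hq.2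
    have h2 := normSq_sub_coe u ⟨q, hq.1.memℓp⟩
    simp only [Set.mem_ofPred_eq, normSq_sub_coe]
    rw [← h2] at this
    nlinarith [sq_nonneg ‖(⟨q, hq.1.memℓp⟩ : EllTwo) - v‖]
  have huniq : ∀ p, p ∈ convexPmfs →
      IsMinOn (fun q => normSq ((u : ℕ → ℝ) - q)) convexPmfs p → p = v := by
    intro q hq hqmin
    have h1 := norm_sq_add_le_of_projection h (w := ⟨q, hq.1.memℓp⟩) hq.2
    have h2 := normSq_sub_coe u ⟨q, hq.1.memℓp⟩
    have h3 := hqmin hvP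
    simp only [Set.mem_ofPred_eq, normSq_sub_coe] at h3
    rw [← h2] at h1
    have h4 : ‖(⟨q, hq.1.memℓp⟩ : EllTwo) - v‖ ^ 2 ≤ 0 := by
      change normSq ((u : ℕ → ℝ) - q) ≤ _ at h3
      change _ + _ ≤ normSq ((u : ℕ → ℝ) - q) at h1
      linarith
    have h5 := sub_eq_zero.1 (norm_eq_zero.1 (pow_eq_zero_iff two_ne_zero |>.1
      (le_antisymm h4 (sq_nonneg _))))
    exact congrArg (fun f : EllTwo => (f : ℕ → ℝ)) h5
  refine ⟨⟨v, ⟨hvP, hmin⟩, fun p hp => huniq p hp.1 hp.2⟩, fun p hp hpmin => ?_⟩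
  rw [huniq p hp hpmin, normSq_sub_coe, Real.sqrt_sq (norm_nonneg _),
    infDist_eq_of_projection hv h]

theorem argminOn_spec {α : Type*} [Nonempty α] {f : α → ℝ} {C : Set α}
    (h : ∃ x, x ∈ C ∧ IsMinOn f C x) : argminOn f C ∈ C ∧ IsMinOn f C (argminOn f C) :=
  Classical.epsilon_spec h

/-! ### The test statistic as a distance -/

/-- The empirical probability mass function as an element of `ℓ²`. -/
noncomputable def empirical {Ω : Type*} (X : ℕ → Ω → ℕ) (n : ℕ) (ω : Ω) : EllTwo :=
  (n : ℝ)⁻¹ • ∑ i ∈ Finset.range n, lp.single 2 (X i ω) (1 : ℝ)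

theorem coe_empirical {Ω : Type*} (X : ℕ → Ω → ℕ) (n : ℕ) (ω : Ω) :
    (empirical X n ω : ℕ → ℝ) = empiricalPmf X n ω := by
  ext j
  rw [empirical, lp.coeFn_smul, lp.coeFn_sum, Pi.smul_apply, Finset.sum_apply, empiricalPmf,
    smul_eq_mul]
  congr 1
  refine Finset.sum_congr rfl fun i _ => ?_
  simp [Pi.single_apply, eq_comm]

theorem isPmf_empiricalPmf {Ω : Type*} (X : ℕ → Ω → ℕ) {n : ℕ} (hn : 1 ≤ n) (ω : Ω) :
    IsPmf (empiricalPmf X n ω) := by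
  refine ⟨fun k => mul_nonneg (by positivity) (Finset.sum_nonneg fun i _ => by
    split_ifs <;> norm_num), ?_⟩
  have h : HasSum (fun j => ∑ i ∈ Finset.range n, if X i ω = j then (1 : ℝ) else 0)
      (∑ i ∈ Finset.range n, 1) :=
    hasSum_sum fun i _ => by
      simpa [eq_comm] using hasSum_ite_eq (X i ω) (1 : ℝ)
  have h2 := h.mul_left (n : ℝ)⁻¹
  have hn0 : (n : ℝ) ≠ 0 := by positivity
  simp only [Finset.sum_const, Finset.card_range, nsmul_eq_mul, mul_one, inv_mul_cancel₀ hn0] at h2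
  exact h2

theorem existsUnique_convexLSE {Ω : Type*} (X : ℕ → Ω → ℕ) {n : ℕ} (hn : 1 ≤ n) (ω : Ω) :
    ∃! p, p ∈ convexPmfs ∧ IsMinOn (fun q => normSq (empiricalPmf X n ω - q)) convexPmfs p := by
  have := (exists_unique_convexFit (u := empirical X n ω)
    (by rw [coe_empirical]; exact isPmf_empiricalPmf X hn ω)).1
  rwa [coe_empirical] at this

theorem infDist_smul_convexCone (f : EllTwo) {c : ℝ} (hc : 0 ≤ c) :
    Metric.infDist (c • f) convexCone = c * Metric.infDist f convexCone := by
  obtain ⟨v, hv, h⟩ := exists_projection ⟨0, zero_mem_convexCone⟩ isClosed_convexCone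
    convex_convexCone f
  have h0 : inner ℝ (f - v) v = 0 := by
    refine le_antisymm (inner_le_zero_of_projection_convexCone hv h hv) ?_
    simpa using h 0 zero_mem_convexCone
  rw [infDist_eq_of_projection hv h, infDist_eq_of_projection (smul_mem_convexCone hv hc),
    ← smul_sub, norm_smul, Real.norm_of_nonneg hc]
  intro w hw
  rw [← smul_sub, inner_smul_left, inner_sub_right, inner_smul_right, h0]
  simpa using mul_nonpos_of_nonneg_of_nonpos hc (inner_le_zero_of_projection_convexCone hv h hw)

theorem testStat_eq_infDist {Ω : Type*} (X : ℕ → Ω → ℕ) (n : ℕ) (ω : Ω) :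
    testStat X n ω = Metric.infDist (√(n : ℝ) • empirical X n ω) convexCone := by
  rw [infDist_smul_convexCone _ (Real.sqrt_nonneg _), testStat]
  obtain rfl | hn := Nat.eq_zero_or_pos n
  · simp
  congr 1
  have hu := exists_unique_convexFit (u := empirical X n ω)
    (by rw [coe_empirical]; exact isPmf_empiricalPmf X hn ω)
  rw [coe_empirical] at hu
  obtain ⟨h1, h2⟩ := argminOn_spec (existsUnique_convexLSE X hn ω).exists
  exact hu.2 _ h1 h2

/-! ### Extension by zero -/

/-- Extension of a vector `(g(0), …, g(S+1))` by zero to an element of `ℓ²`. -/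
noncomputable def zeroExtend (S : ℕ) : EuclideanSpace ℝ (Fin (S + 2)) →ₗ[ℝ] EllTwo where
  toFun g := ∑ k : Fin (S + 2), lp.single 2 (k : ℕ) (g k)
  map_add' g h := by
    rw [← Finset.sum_add_distrib]
    exact Finset.sum_congr rfl fun k _ => lp.single_add 2 _ _ _
  map_smul' c g := by
    rw [Finset.smul_sum]
    exact Finset.sum_congr rfl fun k _ => lp.single_smul 2 _ c _

variable {S : ℕ}

theorem zeroExtend_eq_sum (g : EuclideanSpace ℝ (Fin (S + 2))) (j : ℕ) :
    zeroExtend S g j = ∑ k : Fin (S + 2), if j = k then g k else 0 := by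
  simp only [zeroExtend, LinearMap.coe_mk, AddHom.coe_mk]
  rw [lp.coeFn_sum, Finset.sum_apply]
  refine Finset.sum_congr rfl fun k _ => ?_
  simp [Pi.single_apply]

theorem zeroExtend_apply_fin (g : EuclideanSpace ℝ (Fin (S + 2))) (k : Fin (S + 2)) :
    zeroExtend S g k = g k := by
  rw [zeroExtend_eq_sum, Finset.sum_eq_single k]
  · simp
  · intro i _ hi
    rw [if_neg fun h => hi (Fin.ext h.symm)]
  · simp

theorem zeroExtend_apply_of_lt (g : EuclideanSpace ℝ (Fin (S + 2))) {j : ℕ} (hj : j < S + 2) :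
    zeroExtend S g j = g ⟨j, hj⟩ := zeroExtend_apply_fin g ⟨j, hj⟩

theorem zeroExtend_apply_of_le (g : EuclideanSpace ℝ (Fin (S + 2))) {j : ℕ} (hj : S + 2 ≤ j) :
    zeroExtend S g j = 0 := by
  rw [zeroExtend_eq_sum]
  refine Finset.sum_eq_zero fun k _ => if_neg ?_
  have := k.2
  omega

theorem sum_sq_le_norm_sq (f : EllTwo) (n : ℕ) : ∑ k : Fin n, f k ^ 2 ≤ ‖f‖ ^ 2 := by
  rw [← normSq_coe, normSq, Fin.sum_univ_eq_sum_range (fun k => f k ^ 2)]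
  exact (summable_sq_ellTwo f).sum_le_tsum _ fun _ _ => sq_nonneg _

theorem norm_zeroExtend (g : EuclideanSpace ℝ (Fin (S + 2))) : ‖zeroExtend S g‖ = ‖g‖ := by
  have h : ‖zeroExtend S g‖ ^ 2 = ‖g‖ ^ 2 := by
    rw [EuclideanSpace.norm_sq_eq, ← normSq_coe, normSq,
      tsum_eq_sum (s := Finset.range (S + 2)), ← Fin.sum_univ_eq_sum_range
        (fun k => zeroExtend S g k ^ 2)]
    · simp [zeroExtend_apply_fin]
    · intro j hj
      rw [zeroExtend_apply_of_le g (by simpa using hj)]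
      simp
  exact (sq_eq_sq₀ (norm_nonneg _) (norm_nonneg _)).1 h

theorem continuous_zeroExtend : Continuous (zeroExtend S) :=
  (zeroExtend S).continuous_of_finiteDimensional

/-! ### The cone `𝒦₀` -/

theorem zero_mem_knotCone (p : ℕ → ℝ) (S : ℕ) : 0 ∈ knotCone p S := fun k _ _ _ => by simp

theorem convex_knotCone (p : ℕ → ℝ) (S : ℕ) : Convex ℝ (knotCone p S) := by
  intro f hf g hg a b ha hb _ k h1 h2 h3
  have h4 := mul_nonneg ha (hf k h1 h2 h3)
  have h5 := mul_nonneg hb (hg k h1 h2 h3)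
  simp only [PiLp.add_apply, PiLp.smul_apply, smul_eq_mul]
  linarith

theorem isClosed_knotCone (p : ℕ → ℝ) (S : ℕ) : IsClosed (knotCone p S) := by
  simp only [knotCone, Set.ofPred_forall]
  refine isClosed_iInter fun k => isClosed_iInter fun h1 => isClosed_iInter fun h2 =>
    isClosed_iInter fun h3 => isClosed_le continuous_const ?_
  fun_prop

theorem sumSq_eq_norm_sq (u g : EuclideanSpace ℝ (Fin (S + 2))) : sumSq u g = ‖u - g‖ ^ 2 := by
  rw [norm_sub_rev, EuclideanSpace.norm_sq_eq]
  simp [sumSq]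

theorem existsUnique_coneProj (p : ℕ → ℝ) (u : EuclideanSpace ℝ (Fin (S + 2))) :
    (∃! g, g ∈ knotCone p S ∧ IsMinOn (sumSq u) (knotCone p S) g) ∧
    √(∑ k, (coneProj p S u k - u k) ^ 2) = Metric.infDist u (knotCone p S) := by
  obtain ⟨v, hv, h⟩ := exists_projection ⟨0, zero_mem_knotCone p S⟩ (isClosed_knotCone p S)
    (convex_knotCone p S) u
  have hmin : IsMinOn (sumSq u) (knotCone p S) v := by
    intro w hw
    simp only [Set.mem_ofPred_eq, sumSq_eq_norm_sq]
    linarith [norm_sq_add_le_of_projection h hw, sq_nonneg ‖w - v‖]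
  have huniq : ∀ w, w ∈ knotCone p S → IsMinOn (sumSq u) (knotCone p S) w → w = v := by
    intro w hw hwmin
    have h1 := norm_sq_add_le_of_projection h hw
    have h2 := hwmin hv
    simp only [Set.mem_ofPred_eq, sumSq_eq_norm_sq] at h2
    have h3 : ‖w - v‖ ^ 2 ≤ 0 := by linarith
    exact sub_eq_zero.1 (norm_eq_zero.1 (pow_eq_zero_iff two_ne_zero |>.1
      (le_antisymm h3 (sq_nonneg _))))
  refine ⟨⟨v, ⟨hv, hmin⟩, fun w hw => huniq w hw.1 hw.2⟩, ?_⟩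
  obtain ⟨h1, h2⟩ := argminOn_spec (f := sumSq u) (C := knotCone p S) ⟨v, hv, hmin⟩
  have hcp : coneProj p S u = v := huniq _ h1 h2
  rw [hcp, infDist_eq_of_projection hv h]
  change √(sumSq u v) = _
  rw [sumSq_eq_norm_sq, Real.sqrt_sq (norm_nonneg _)]

/-! ### Distances to the translated cones -/

/-- The distance from `g + t p` to the cone of convex sequences. -/
noncomputable def shiftedDist (S : ℕ) (p : EllTwo) (t : ℝ)
    (g : EuclideanSpace ℝ (Fin (S + 2))) : ℝ :=
  Metric.infDist (zeroExtend S g + t • p) convexCone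

theorem continuous_shiftedDist (p : EllTwo) (t : ℝ) : Continuous (shiftedDist S p t) :=
  (Metric.continuous_infDist_pt _).comp (continuous_zeroExtend.add continuous_const)

/-- Raising the shift from s to t can be matched by moving any competitor w to w + (t - s) p, still
in the cone. -/
theorem antitone_shiftedDist {p : EllTwo} (hp : p ∈ convexCone)
    (g : EuclideanSpace ℝ (Fin (S + 2))) : Antitone fun t => shiftedDist S p t g := by
  intro s t hst
  refine (Metric.le_infDist ⟨0, zero_mem_convexCone⟩).2 fun w hw => ?_
  have hmem : w + (t - s) • p ∈ convexCone :=
    add_mem_convexCone hw (smul_mem_convexCone hp (sub_nonneg.2 hst))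
  refine (Metric.infDist_le_dist_of_mem hmem).trans_eq ?_
  rw [dist_eq_norm, dist_eq_norm, sub_smul]
  congr 1
  abel

/-- For w convex, w - t p cut down to {0, …, S+1} lies in the knot cone, and cutting down only
shortens the difference. -/
theorem infDist_knotCone_le_shiftedDist {p : EllTwo} {t : ℝ} (ht : 0 ≤ t)
    (g : EuclideanSpace ℝ (Fin (S + 2))) :
    Metric.infDist g (knotCone p S) ≤ shiftedDist S p t g := by
  refine (Metric.le_infDist ⟨0, zero_mem_convexCone⟩).2 fun w hw => ?_
  let h : EuclideanSpace ℝ (Fin (S + 2)) := WithLp.toLp 2 fun k => (w - t • p : EllTwo) k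
  have hh : h ∈ knotCone p S := by
    intro k h1 h2 h3
    have h4 := hw k h1
    simp only [IsKnot, h1, true_and, not_lt, secondDiff] at h3
    simp only [secondDiff] at h4
    simp only [h, lp.coeFn_sub, lp.coeFn_smul, Pi.sub_apply, Pi.smul_apply, smul_eq_mul]
    nlinarith
  refine (Metric.infDist_le_dist_of_mem hh).trans ?_
  rw [dist_eq_norm, dist_eq_norm]
  refine le_of_sq_le_sq ?_ (norm_nonneg _)
  refine le_trans (le_of_eq ?_) (sum_sq_le_norm_sq _ (S + 2))
  rw [EuclideanSpace.norm_sq_eq]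
  refine Finset.sum_congr rfl fun k _ => ?_
  simp only [h, PiLp.sub_apply, lp.coeFn_sub, lp.coeFn_smul, lp.coeFn_add, Pi.sub_apply,
    Pi.add_apply, Pi.smul_apply, zeroExtend_apply_fin, Real.norm_eq_abs, sq_abs]
  ring

/-- The last coordinate enters only the constraint at S, with coefficient +1. A negative value could
thus be raised to 0 = g(S+1), bringing v closer to g. -/
theorem projection_knotCone_last_nonneg {p : ℕ → ℝ} {g v : EuclideanSpace ℝ (Fin (S + 2))}
    (hg : g (Fin.last (S + 1)) = 0) (hv : v ∈ knotCone p S)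
    (h : ∀ w ∈ knotCone p S, inner ℝ (g - v) (w - v) ≤ 0) : 0 ≤ v (Fin.last (S + 1)) := by
  by_contra! hneg
  have hmem : v + EuclideanSpace.single (Fin.last (S + 1)) (-v (Fin.last (S + 1)))
      ∈ knotCone p S := by
    intro k h1 h2 h3
    have h4 := hv k h1 h2 h3
    have h5 : (⟨k, by omega⟩ : Fin (S + 2)) ≠ Fin.last (S + 1) := by
      simp only [ne_eq, Fin.ext_iff, Fin.val_last]; omega
    have h6 : (⟨k - 1, by omega⟩ : Fin (S + 2)) ≠ Fin.last (S + 1) := by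
      simp only [ne_eq, Fin.ext_iff, Fin.val_last]; omega
    simp only [PiLp.add_apply, PiLp.single_apply, h5, h6, if_false, add_zero]
    split_ifs <;> linarith
  have h1 := h _ hmem
  rw [add_sub_cancel_left, EuclideanSpace.inner_single_right] at h1
  simp only [PiLp.sub_apply, hg, zero_sub, conj_trivial] at h1
  nlinarith

theorem eventually_zeroExtend_add_smul_mem {p : EllTwo} (hp : p ∈ convexCone)
    (hknot : IsKnot p (S + 1)) {v : EuclideanSpace ℝ (Fin (S + 2))} (hv : v ∈ knotCone p S)
    (hlast : 0 ≤ v (Fin.last (S + 1))) :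
    ∀ᶠ t : ℝ in atTop, zeroExtend S v + t • p ∈ convexCone := by
  have hsd : ∀ (t : ℝ) (k : ℕ), secondDiff (zeroExtend S v + t • p : EllTwo) k
      = secondDiff (zeroExtend S v) k + t * secondDiff p k := by
    intro t k
    simp only [secondDiff, lp.coeFn_add, lp.coeFn_smul, Pi.add_apply, Pi.smul_apply, smul_eq_mul]
    ring
  have hfin : ∀ᶠ t : ℝ in atTop, ∀ k ∈ Finset.Icc 1 (S + 1),
      0 ≤ secondDiff (zeroExtend S v + t • p : EllTwo) k := by
    rw [Finset.eventually_all]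
    intro k hk
    rw [Finset.mem_Icc] at hk
    by_cases hkn : IsKnot p k
    · filter_upwards [(tendsto_id.atTop_mul_const hkn.2).eventually_ge_atTop
        (-secondDiff (zeroExtend S v) k)] with t ht
      rw [hsd]
      simp only [id] at ht
      linarith
    · have hkS : k ≤ S := by
        by_contra hc
        exact hkn (by rwa [show k = S + 1 by omega])
      filter_upwards [eventually_ge_atTop 0] with t ht
      rw [hsd]
      refine add_nonneg ?_ (mul_nonneg ht (hp k hk.1))
      have := hv k hk.1 hkS hkn
      rwa [secondDiff, zeroExtend_apply_of_lt v (show k + 1 < S + 2 by omega),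
        zeroExtend_apply_of_lt v (show k < S + 2 by omega),
        zeroExtend_apply_of_lt v (show k - 1 < S + 2 by omega)]
  filter_upwards [hfin, eventually_ge_atTop 0] with t ht ht0 k hk
  by_cases hkS : k ≤ S + 1
  · exact ht k (Finset.mem_Icc.2 ⟨hk, hkS⟩)
  · rw [hsd]
    refine add_nonneg ?_ (mul_nonneg ht0 (hp k hk))
    rw [secondDiff, zeroExtend_apply_of_le v (show S + 2 ≤ k + 1 by omega),
      zeroExtend_apply_of_le v (show S + 2 ≤ k by omega)]
    -- At k = S + 2 the second difference of the extension is v(S+1), which is where `hlast` is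
    -- needed.
    obtain rfl | hk' := eq_or_lt_of_le (show S + 2 ≤ k by omega)
    · rw [zeroExtend_apply_of_lt v (show S + 2 - 1 < S + 2 by omega)]
      have hl : 0 ≤ v ⟨S + 2 - 1, by omega⟩ := hlast
      simpa using hl
    · rw [zeroExtend_apply_of_le v (show S + 2 ≤ k - 1 by omega)]
      simp

theorem eventually_shiftedDist_eq {p : EllTwo} (hp : p ∈ convexCone)
    (hknot : IsKnot p (S + 1)) {g : EuclideanSpace ℝ (Fin (S + 2))}
    (hg : g (Fin.last (S + 1)) = 0) :
    ∀ᶠ t : ℝ in atTop, shiftedDist S p t g = Metric.infDist g (knotCone p S) := by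
  obtain ⟨v, hv, h⟩ := exists_projection ⟨0, zero_mem_knotCone p S⟩ (isClosed_knotCone p S)
    (convex_knotCone p S) g
  filter_upwards [eventually_zeroExtend_add_smul_mem hp hknot hv
    (projection_knotCone_last_nonneg hg hv h), eventually_ge_atTop 0] with t ht ht0
  refine le_antisymm ?_ (infDist_knotCone_le_shiftedDist ht0 g)
  refine (Metric.infDist_le_dist_of_mem ht).trans_eq ?_
  rw [infDist_eq_of_projection hv h, dist_add_right, dist_eq_norm, ← map_sub, norm_zeroExtend]

/-! ### Convergence in distribution along a decreasing sequence of functions -/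

/-- If `X n` converges in distribution to `Z`, and `F n` is a decreasing sequence of continuous
functions, bounded below by a continuous `f`, which converges to `f` almost everywhere for the law
of `Z`, then `F n (X n)` converges in distribution to `f Z`. -/
theorem tendstoInDistribution_of_antitone {Ω Ω' E : Type*} [MeasurableSpace Ω] [MeasurableSpace Ω']
    {P : Measure Ω} [IsProbabilityMeasure P] {P' : Measure Ω'} [IsProbabilityMeasure P']
    [TopologicalSpace E] [MeasurableSpace E] [BorelSpace E] [HasOuterApproxClosed E]
    {X : ℕ → Ω → E} {Z : Ω' → E} (hX : TendstoInDistribution X atTop Z (fun _ => P) P')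
    {F : ℕ → E → ℝ} {f : E → ℝ} (hF : ∀ n, Continuous (F n)) (hf : Continuous f)
    (hanti : ∀ x, Antitone fun n => F n x) (hle : ∀ n x, f x ≤ F n x)
    (hlim : ∀ᵐ ω ∂P', Tendsto (fun n => F n (Z ω)) atTop (𝓝 (f (Z ω)))) :
    TendstoInDistribution (fun n ω => F n (X n ω)) atTop (fun ω => f (Z ω)) (fun _ => P) P' := by
  -- Slutsky: f(Xₙ) converges by continuous mapping, so it suffices that Fₙ(Xₙ) - f(Xₙ) tends to 0
  -- in probability.
  refine tendstoInDistribution_of_tendstoInMeasure_sub (X := fun n ω => f (X n ω)) _ _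
    (hX.continuous_comp hf) ?_ (fun n => (hF n).measurable.comp_aemeasurable
      (hX.forall_aemeasurable n))
  rw [tendstoInMeasure_iff_norm]
  intro ε hε
  -- These closed sets decrease to a null set for the law of Z. Fixing m, the portmanteau theorem
  -- bounds the probability that Xₙ ∈ A m, and A n ⊆ A m for n ≥ m.
  let A (m : ℕ) : Set E := {x | ε ≤ F m x - f x}
  have hAcl (m : ℕ) : IsClosed (A m) := isClosed_le continuous_const ((hF m).sub hf)
  have hA : Tendsto (fun m => P' (Z ⁻¹' A m)) atTop (𝓝 0) := by
    have h0 : P' (⋂ m, Z ⁻¹' A m) = 0 := by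
      refine measure_mono_null ?_ (ae_iff.1 hlim)
      intro ω hω hconv
      have h1 : Tendsto (fun n => F n (Z ω) - f (Z ω)) atTop (𝓝 0) := by
        simpa using hconv.sub_const (f (Z ω))
      have h2 := ge_of_tendsto' h1 fun m => (Set.mem_iInter.1 hω m : ε ≤ F m (Z ω) - f (Z ω))
      linarith
    rw [← h0]
    refine tendsto_measure_iInter_atTop
      (fun m => hX.aemeasurable_limit.nullMeasurableSet_preimage (hAcl m).measurableSet) ?_
      ⟨0, measure_ne_top _ _⟩
    intro m n hmn ω (hω : ε ≤ F n (Z ω) - f (Z ω))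
    exact hω.trans (sub_le_sub_right (hanti _ hmn) _)
  rw [ENNReal.tendsto_nhds_zero]
  intro δ hδ
  obtain ⟨m, hm⟩ := (hA.eventually_lt_const hδ).exists
  have hlimsup := ProbabilityMeasure.limsup_measure_closed_le_of_tendsto hX.tendsto (hAcl m)
  simp only [ProbabilityMeasure.coe_mk] at hlimsup
  rw [Measure.map_apply_of_aemeasurable hX.aemeasurable_limit (hAcl m).measurableSet] at hlimsup
  have hev := eventually_lt_of_limsup_lt (hlimsup.trans_lt hm)
  filter_upwards [hev, eventually_ge_atTop m] with n hn hmn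
  rw [Measure.map_apply_of_aemeasurable (hX.forall_aemeasurable n) (hAcl m).measurableSet] at hn
  refine (measure_mono fun ω hω => ?_).trans hn.le
  simp only [Set.mem_ofPred_eq, Pi.sub_apply, Pi.zero_apply, sub_zero, Real.norm_eq_abs] at hω
  rw [abs_of_nonneg (sub_nonneg.2 (hle n _))] at hω
  exact hω.trans (sub_le_sub_right (hanti _ hmn) _)

/-! ### The multivariate central limit theorem for the empirical distribution -/

section CentralLimit

variable {Ω : Type*} [MeasurableSpace Ω] {P : Measure Ω} [IsProbabilityMeasure P] {S : ℕ}

theorem integral_zeroExtend_comp {Y : Ω → ℕ} (hY : Measurable Y) {p : ℕ → ℝ}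
    (hlaw : ∀ j, P.real {ω | Y ω = j} = p j) (t : EuclideanSpace ℝ (Fin (S + 2))) :
    ∫ ω, zeroExtend S t (Y ω) ∂P = ∑ k, t k * p k := by
  have hms (k : ℕ) : MeasurableSet {ω | Y ω = k} := hY (measurableSet_singleton k)
  have heq (k : Fin (S + 2)) : (fun ω => if Y ω = k then t k else 0)
      = {ω | Y ω = k}.indicator fun _ => t k := by
    ext ω
    simp [Set.indicator_apply]
  simp_rw [zeroExtend_eq_sum]
  rw [integral_finsetSum]
  · refine Finset.sum_congr rfl fun k _ => ?_
    rw [heq, integral_indicator_const _ (hms k), hlaw, smul_eq_mul, mul_comm]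
  · intro k _
    rw [heq]
    exact (integrable_const _).indicator (hms k)

theorem memLp_zeroExtend_comp {Y : Ω → ℕ} (hY : Measurable Y)
    (t : EuclideanSpace ℝ (Fin (S + 2))) : MemLp (fun ω => zeroExtend S t (Y ω)) 2 P :=
  MemLp.of_bound ((measurable_from_top.comp hY).aestronglyMeasurable) ‖zeroExtend S t‖
    (ae_of_all _ fun _ => lp.norm_apply_le_norm (by norm_num) _ _)

theorem dotProduct_dispersion_mulVec (p : ℕ → ℝ) (x : Fin (S + 2) → ℝ) :
    x ⬝ᵥ (dispersion p S).mulVec x = ∑ k, x k ^ 2 * p k - (∑ k, x k * p k) ^ 2 := by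
  simp only [dotProduct, Matrix.mulVec, dispersion, Matrix.of_apply, sub_mul,
    Finset.sum_sub_distrib, mul_sub, ite_mul, zero_mul, Finset.sum_ite_eq, Finset.mem_univ, if_true]
  congr 1
  · exact Finset.sum_congr rfl fun k _ => by ring
  · rw [sq, Finset.sum_mul_sum]
    simp_rw [Finset.mul_sum]
    exact Finset.sum_congr rfl fun i _ => Finset.sum_congr rfl fun j _ => by ring

theorem variance_zeroExtend_comp {Y : Ω → ℕ} (hY : Measurable Y) {p : ℕ → ℝ}
    (hlaw : ∀ j, P.real {ω | Y ω = j} = p j) (t : EuclideanSpace ℝ (Fin (S + 2))) :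
    Var[fun ω => zeroExtend S t (Y ω); P] = t.ofLp ⬝ᵥ (dispersion p S).mulVec t.ofLp := by
  -- Squaring stays within functions of this form, so both moments come from
  -- `integral_zeroExtend_comp`.
  have hsq : (fun ω => zeroExtend S t (Y ω)) ^ 2
      = fun ω => zeroExtend S (WithLp.toLp 2 fun k => t k ^ 2) (Y ω) := by
    ext ω
    simp only [Pi.pow_apply]
    by_cases h : Y ω < S + 2
    · rw [zeroExtend_apply_of_lt _ h, zeroExtend_apply_of_lt _ h]
    · rw [zeroExtend_apply_of_le _ (not_lt.1 h), zeroExtend_apply_of_le _ (not_lt.1 h)]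
      simp
  rw [variance_eq_sub (memLp_zeroExtend_comp hY t), hsq, integral_zeroExtend_comp hY hlaw,
    integral_zeroExtend_comp hY hlaw, dotProduct_dispersion_mulVec]

/-- Its quadratic form is a variance. -/
theorem posSemidef_dispersion {Y : Ω → ℕ} (hY : Measurable Y) {p : ℕ → ℝ}
    (hlaw : ∀ j, P.real {ω | Y ω = j} = p j) : (dispersion p S).PosSemidef := by
  refine .of_dotProduct_mulVec_nonneg ?_ fun x => ?_
  · ext i j
    by_cases h : i = j
    · simp [dispersion, h]
    · simp [dispersion, h, Ne.symm h, mul_comm]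
  · rw [star_trivial]
    have := variance_zeroExtend_comp hY hlaw (WithLp.toLp 2 x)
    simp only at this
    rw [← this]
    exact variance_nonneg _ _

/-- The fluctuation vector `√n (pₙ - p)`, restricted to `{0, …, S + 1}`. -/
noncomputable def fluctuation {Ω : Type*} (S : ℕ) (p : ℕ → ℝ) (X : ℕ → Ω → ℕ) (n : ℕ) (ω : Ω) :
    EuclideanSpace ℝ (Fin (S + 2)) :=
  WithLp.toLp 2 fun k => √(n : ℝ) * (empiricalPmf X n ω k - p k)

theorem measurable_fluctuation {X : ℕ → Ω → ℕ} (hX : ∀ i, Measurable (X i)) (p : ℕ → ℝ) (n : ℕ) :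
    Measurable (fluctuation S p X n) := by
  refine (WithLp.measurable_toLp 2 _).comp (measurable_pi_lambda _ fun k => ?_)
  simp only [empiricalPmf]
  refine ((Measurable.const_mul (Finset.measurable_fun_sum _ fun i _ => ?_) _).sub_const
    _).const_mul _
  exact Measurable.ite (hX i (measurableSet_singleton _)) measurable_const measurable_const

/-- The Cramér–Wold reduction: each linear functional of the fluctuation is a normalized sum of
scalar functions of the observations. -/
theorem inner_fluctuation {Ω : Type*} (p : ℕ → ℝ) (X : ℕ → Ω → ℕ) (n : ℕ) (ω : Ω)
    (t : EuclideanSpace ℝ (Fin (S + 2))) :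
    inner ℝ (fluctuation S p X n ω) t
      = (√(n : ℝ))⁻¹ * (∑ i ∈ Finset.range n, zeroExtend S t (X i ω) - n * ∑ k, t k * p k) := by
  have h1 : √(n : ℝ) * (n : ℝ)⁻¹ = (√(n : ℝ))⁻¹ := by
    rw [← div_eq_mul_inv, Real.sqrt_div_self]
  have h2 : (√(n : ℝ))⁻¹ * n = √(n : ℝ) := by
    rw [mul_comm, ← div_eq_mul_inv, Real.div_sqrt]
  simp_rw [zeroExtend_eq_sum]
  rw [Finset.sum_comm, mul_sub, ← mul_assoc, h2, ← h1, Finset.mul_sum, Finset.mul_sum,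
    ← Finset.sum_sub_distrib, PiLp.inner_apply]
  refine Finset.sum_congr rfl fun k _ => ?_
  simp only [fluctuation, empiricalPmf, RCLike.inner_apply, conj_trivial]
  have h3 : ∑ i ∈ Finset.range n, (if X i ω = k then t k else 0)
      = t k * ∑ i ∈ Finset.range n, if X i ω = k then (1 : ℝ) else 0 := by
    rw [Finset.mul_sum]
    exact Finset.sum_congr rfl fun i _ => by simp
  rw [h3]
  ring

theorem identDistrib_of_law {X : ℕ → Ω → ℕ} (hX : ∀ i, Measurable (X i)) {p : ℕ → ℝ}
    (hlaw : ∀ i j, P.real {ω | X i ω = j} = p j) (i : ℕ) : IdentDistrib (X i) (X 0) P P := by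
  refine ⟨(hX i).aemeasurable, (hX 0).aemeasurable, Measure.ext_of_singleton fun j => ?_⟩
  rw [Measure.map_apply (hX i) (measurableSet_singleton j),
    Measure.map_apply (hX 0) (measurableSet_singleton j)]
  refine (measureReal_eq_measureReal_iff).1 ?_
  exact (hlaw i j).trans (hlaw 0 j).symm

theorem tendstoInDistribution_fluctuation {Ω' : Type*} [MeasurableSpace Ω'] {P' : Measure Ω'}
    [IsProbabilityMeasure P'] {p : ℕ → ℝ} {X : ℕ → Ω → ℕ} (hX : ∀ i, Measurable (X i))
    (hindep : iIndepFun X P) (hlaw : ∀ i j, P.real {ω | X i ω = j} = p j)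
    {g : Ω' → EuclideanSpace ℝ (Fin (S + 2))}
    (hg : HasLaw g (multivariateGaussian 0 (dispersion p S)) P') :
    TendstoInDistribution (fluctuation S p X) atTop g (fun _ => P) P' where
  forall_aemeasurable n := (measurable_fluctuation hX p n).aemeasurable
  aemeasurable_limit := hg.aemeasurable
  tendsto := by
    refine ProbabilityMeasure.tendsto_iff_tendsto_charFun.2 fun t => ?_
    have hm : Measurable fun j : ℕ => zeroExtend S t j := measurable_from_top
    have hclt := tendstoInDistribution_inv_sqrt_mul_sum_sub (P := P)
      (X := fun i ω => zeroExtend S t (X i ω)) HasLaw.id (memLp_zeroExtend_comp (hX 0) t)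
      (hindep.comp (fun _ j => zeroExtend S t j) fun _ => hm)
      fun i => (identDistrib_of_law hX hlaw i).comp hm
    -- The vector characteristic function at t is that of the scalar projection along t at frequency
    -- 1.
    have hchar := ProbabilityMeasure.tendsto_iff_tendsto_charFun.1 hclt.tendsto 1
    simp only [ProbabilityMeasure.coe_mk, Measure.map_id, charFun_gaussianReal] at hchar ⊢
    rw [hg.map_eq, charFun_multivariateGaussian (posSemidef_dispersion (hX 0) (hlaw 0))]
    rw [Real.coe_toNNReal _ (variance_nonneg _ _), variance_zeroExtend_comp (hX 0) (hlaw 0)]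
      at hchar
    convert hchar using 2 with n
    · rw [charFun_apply, charFun_apply, integral_map (measurable_fluctuation hX p n).aemeasurable
        (by fun_prop), integral_map (hclt.forall_aemeasurable n) (by fun_prop)]
      simp_rw [inner_fluctuation, integral_zeroExtend_comp (hX 0) (hlaw 0)]
      simp
    · simp

end CentralLimit

/-! ### The limit distribution of the test statistic -/

/-- Only almost sure: observations may exceed S on a null set, and the fluctuation vector does not
see values beyond S + 1. -/
theorem ae_testStat_eq_shiftedDist {Ω : Type*} [MeasurableSpace Ω] {P : Measure Ω}
    [IsProbabilityMeasure P] {S : ℕ} {p : EllTwo} (hsupp : Function.support p = {k | k ≤ S})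
    {X : ℕ → Ω → ℕ} (hlaw : ∀ i j, P.real {ω | X i ω = j} = p j) (n : ℕ) :
    (fun ω => shiftedDist S p √(n : ℝ) (fluctuation S p X n ω)) =ᵐ[P] testStat X n := by
  have hzero : ∀ j, S < j → p j = 0 := fun j hj => by
    by_contra hc
    have : j ∈ Function.support p := hc
    rw [hsupp] at this
    exact absurd hj (not_lt.2 this)
  have hle : ∀ᵐ ω ∂P, ∀ i j, S < j → X i ω ≠ j := by
    refine ae_all_iff.2 fun i => ae_all_iff.2 fun j => ?_
    by_cases hj : S < j
    · have h := hlaw i j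
      rw [hzero j hj, measureReal_eq_zero_iff] at h
      filter_upwards [measure_eq_zero_iff_ae_notMem.1 h] with ω hω _
      exact hω
    · exact ae_of_all _ fun ω h => absurd h hj
  filter_upwards [hle] with ω hω
  rw [testStat_eq_infDist, shiftedDist]
  congr 1
  ext j
  simp only [lp.coeFn_add, lp.coeFn_smul, Pi.add_apply, Pi.smul_apply, smul_eq_mul, coe_empirical]
  by_cases hj : j < S + 2
  · rw [zeroExtend_apply_of_lt _ hj]
    simp only [fluctuation]
    ring
  · rw [zeroExtend_apply_of_le _ (not_lt.1 hj), hzero j (by omega), empiricalPmf,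
      Finset.sum_eq_zero fun i _ => if_neg (hω i j (by omega))]
    simp

/-- The last marginal is Gaussian with variance p(S+1) - p(S+1)² = 0, hence a point mass at 0. -/
theorem ae_last_eq_zero {Ω' : Type*} [MeasurableSpace Ω'] {P' : Measure Ω'} {S : ℕ} {p : ℕ → ℝ}
    (hpsd : (dispersion p S).PosSemidef) (hp : p (S + 1) = 0)
    {g : Ω' → EuclideanSpace ℝ (Fin (S + 2))}
    (hg : HasLaw g (multivariateGaussian 0 (dispersion p S)) P') :
    ∀ᵐ ω ∂P', g ω (Fin.last (S + 1)) = 0 := by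
  have h := (measurePreserving_eval_multivariateGaussian (μ := 0) hpsd
    (i := Fin.last (S + 1))).map_eq
  have hvar : dispersion p S (Fin.last (S + 1)) (Fin.last (S + 1)) = 0 := by
    simp [dispersion, hp]
  rw [hvar, Real.toNNReal_zero, gaussianReal_zero_var, ← hg.map_eq,
    AEMeasurable.map_map_of_aemeasurable
    (by fun_prop) hg.aemeasurable] at h
  have h0 : ∀ᵐ x ∂(Measure.dirac (0 : ℝ)), x = 0 := by
    rw [ae_dirac_eq]
    rfl
  have h1 : (0 : EuclideanSpace ℝ (Fin (S + 2))) (Fin.last (S + 1)) = 0 := rfl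
  rw [h1] at h
  rw [← h] at h0
  exact ae_of_ae_map (by have := hg.aemeasurable; fun_prop) h0

end ConvexTest

theorem theorem1 {Ω Ω' : Type*} [MeasurableSpace Ω] [MeasurableSpace Ω']
    (P : Measure Ω) [IsProbabilityMeasure P] (P' : Measure Ω') [IsProbabilityMeasure P']
    (S : ℕ) (hS : 0 < S)
    (p₀ : ℕ → ℝ) (hp₀ : p₀ ∈ convexPmfs) (hsupp : Function.support p₀ = {k | k ≤ S})
    (X : ℕ → Ω → ℕ) (hX_meas : ∀ i, Measurable (X i)) (hX_indep : iIndepFun X P)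
    (hX_law : ∀ i j, P.real {ω | X i ω = j} = p₀ j)
    (g₀ : Ω' → EuclideanSpace ℝ (Fin (S + 2)))
    (hg₀ : HasLaw g₀ (multivariateGaussian 0 (dispersion p₀ S)) P') :
    (∀ n, 1 ≤ n → ∀ ω, ∃! p, p ∈ convexPmfs ∧
      IsMinOn (fun q => normSq (empiricalPmf X n ω - q)) convexPmfs p) ∧
    (∀ u, ∃! g, g ∈ knotCone p₀ S ∧ IsMinOn (sumSq u) (knotCone p₀ S) g) ∧
    TendstoInDistribution (testStat X) atTop
      (fun ω' => √(∑ k, (coneProj p₀ S (g₀ ω') k - g₀ ω' k) ^ 2)) (fun _ => P) P' := by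
  refine ⟨fun n hn ω => existsUnique_convexLSE X hn ω, fun u => (existsUnique_coneProj p₀ u).1, ?_⟩
  simp_rw [(existsUnique_coneProj p₀ _).2]
  let p : EllTwo := ⟨p₀, hp₀.1.memℓp⟩
  have hp : p ∈ convexCone := hp₀.2
  have hzero (j : ℕ) (hj : S < j) : p₀ j = 0 := by
    by_contra hc
    have : j ∈ Function.support p₀ := hc
    rw [hsupp] at this
    exact absurd hj (not_lt.2 this)
  -- The second difference at S + 1 is p₀(S) > 0. This is why the knot cone needs no constraint at S
  -- + 1.
  have hknot : IsKnot p (S + 1) := by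
    have h1 : p₀ S ≠ 0 := by
      have : S ∈ Function.support p₀ := by rw [hsupp]; exact le_refl S
      exact this
    refine ⟨by omega, ?_⟩
    change 0 < p₀ (S + 1 + 1) - 2 * p₀ (S + 1) + p₀ (S + 1 - 1)
    rw [hzero _ (by omega), hzero _ (by omega), Nat.add_sub_cancel]
    simpa using (hp₀.1.1 S).lt_of_ne' h1
  have hsqrt : Tendsto (fun n : ℕ => √(n : ℝ)) atTop atTop :=
    Real.tendsto_sqrt_atTop.comp tendsto_natCast_atTop_atTop
  refine TendstoInDistribution.congr (fun n => ae_testStat_eq_shiftedDist (p := p) hsupp hX_law n)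
    EventuallyEq.rfl ?_
  refine tendstoInDistribution_of_antitone (F := fun n => shiftedDist S p √(n : ℝ))
    (f := fun g => Metric.infDist g (knotCone p₀ S))
    (tendstoInDistribution_fluctuation hX_meas hX_indep hX_law hg₀)
    (fun n => continuous_shiftedDist p _) (Metric.continuous_infDist_pt _)
    (fun g m n hmn => antitone_shiftedDist hp g (Real.sqrt_le_sqrt (Nat.cast_le.2 hmn)))
    (fun n g => infDist_knotCone_le_shiftedDist (p := p) (Real.sqrt_nonneg _) g) ?_
  filter_upwards [ae_last_eq_zero (posSemidef_dispersion (hX_meas 0) (hX_law 0))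
    (hzero _ (Nat.lt_succ_self S)) hg₀] with ω hω
  refine tendsto_const_nhds.congr' ?_
  filter_upwards [hsqrt.eventually (eventually_shiftedDist_eq hp hknot hω)] with n hn
  exact hn.symm
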